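/- Let $(\mathcal X,d)$ be a compact metric space, and let $\mathcal M^+(\mathcal X)$ be the set of finite positive Borel measures on $\mathcal X$, with total mass $m(\alpha)=\alpha(\mathcal X)$; $\alpha_n\rightharpoonup\alpha$ (weak* convergence, or convergence in law) means $\int f\,d\alpha_n\to\int f\,d\alpha$ for every $f\in\mathcal C(\mathcal X)$. Let $\varepsilon>0$ and let $C:\mathcal X\times\mathcal X\to\mathbb R$ be a continuous cost with $C(x,y)=C(y,x)$ and $C(x,x)=0$, which is $\gamma$-Lipschitz in each of its variables for some $\gamma\ge 0$. Assume that the kernel $k_\varepsilon=e^{-C/\varepsilon}$ is positive, that is $\iint k_\varepsilon\,d\sigma\,d\sigma\ge 0$ for every finite signed measure $\sigma$ on $\mathcal X$, and universal, that is the linear span of $\{x\mapsto k_\varepsilon(x,y) : y\in\mathcal X\}$ is dense in $\mathcal C(\mathcal X)$ for the uniform norm. Let $\rho>0$ and let $\phi:[0,\infty)\to[0,\infty)$ be either $\phi(p)=\rho(p\log p-p+1)$, with $0\log 0=0$ (the case $D_\phi=\rho\mathrm{KL}$), or $\phi(p)=\rho|p-1|$ (the case $D_\phi=\rho\mathrm{TV}$).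 With $\phi'_\infty=\lim_{p\to\infty}\phi(p)/p$, the Lebesgue decomposition $\mu=\frac{d\mu}{d\nu}\nu+\mu^\perp$ and the convention $\infty\times 0=0$, set $$D_\phi(\mu|\nu)=\int\phi\Big(\frac{d\mu}{d\nu}\Big)\,d\nu+\phi'_\infty\,\mu^\perp(\mathcal X),$$ and let $\mathrm{KL}$ be the divergence of this form, on $\mathcal X\times\mathcal X$, with entropy $p\log p-p+1$. For $\alpha,\beta\in\mathcal M^+(\mathcal X)$, writing $\pi_1,\pi_2$ for the marginals of $\pi$, let $$\mathrm{OT}_\varepsilon(\alpha,\beta)=\inf_{\pi\in\mathcal M^+(\mathcal X\times\mathcal X)}\int C\,d\pi+D_\phi(\pi_1|\alpha)+D_\phi(\pi_2|\beta)+\varepsilon\,\mathrm{KL}(\pi|\alpha\otimes\beta),$$ $$\mathrm S_\varepsilon(\alpha,\beta)=\mathrm{OT}_\varepsilon(\alpha,\beta)-\tfrac12\mathrm{OT}_\varepsilon(\alpha,\alpha)-\tfrac12\mathrm{OT}_\varepsilon(\beta,\beta)+\tfrac{\varepsilon}{2}\big(m(\alpha)-m(\beta)\big)^2.$$ Then the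 Sinkhorn divergence $\mathrm S_\varepsilon$ metrizes the convergence in law: for every sequence $(\alpha_n)_{n}$ of nonzero measures in $\mathcal M^+(\mathcal X)$ and every $\alpha\in\mathcal M^+(\mathcal X)$, $$\alpha_n\rightharpoonup\alpha\quad\Longleftrightarrow\quad \mathrm S_\varepsilon(\alpha_n,\alpha)\to 0.$$ -/

import Mathlib

open MeasureTheory Filter Topology
open scoped NNReal ENNReal

noncomputable section

namespace Sinkhorn

/-- The recession constant `φ'_∞ = lim_{p → +∞} φ(p) / p` of an entropy function (for a convex `φ`
the limit exists, and so it is the limsup). -/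
def recession (φ : ℝ≥0 → ℝ≥0∞) : ℝ≥0∞ :=
  limsup (fun p : ℝ≥0 => φ p / (p : ℝ≥0∞)) atTop

/-- The Csiszár divergence `D_φ(μ|ν) = ∫ φ(dμ/dν) dν + φ'_∞ · μ^⊥(Ω)`, where
`μ = (dμ/dν) ν + μ^⊥` is the Lebesgue decomposition; `∞ · 0 = 0`. -/
def csiszarDiv {Ω : Type*} [MeasurableSpace Ω] (φ : ℝ≥0 → ℝ≥0∞) (μ ν : Measure Ω) : ℝ≥0∞ :=
  (∫⁻ x, φ (μ.rnDeriv ν x).toNNReal ∂ν) + recession φ * μ.singularPart ν Set.univ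

/-- The entropy function of `ρ KL`: `φ(p) = ρ (p log p - p + 1)`. -/
def klEntropy (ρ : ℝ) (p : ℝ≥0) : ℝ≥0∞ :=
  ENNReal.ofReal (ρ * ((p : ℝ) * Real.log p - p + 1))

/-- The entropy function of `ρ TV`: `φ(p) = ρ |p - 1|`. -/
def tvEntropy (ρ : ℝ) (p : ℝ≥0) : ℝ≥0∞ :=
  ENNReal.ofReal (ρ * |(p : ℝ) - 1|)

section Kernels

variable {X : Type*} [TopologicalSpace X]

/-- A kernel `k` is positive if `∬ k dσ dσ ≥ 0` for every finite signed measure `σ`. A finite signed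
measure is a difference `σ = μ - ν` of two finite positive measures, and `∬ k dσ dσ` is expanded
accordingly. -/
def IsPositiveKernel [MeasurableSpace X] (k : C(X × X, ℝ)) : Prop :=
  ∀ μ ν : FiniteMeasure X,
    0 ≤ (∫ p, k p ∂((μ : Measure X).prod (μ : Measure X)))
      - (∫ p, k p ∂((μ : Measure X).prod (ν : Measure X)))
      - (∫ p, k p ∂((ν : Measure X).prod (μ : Measure X)))
      + (∫ p, k p ∂((ν : Measure X).prod (ν : Measure X)))

/-- The function `x ↦ k(x, y)`. -/
def kernelSection (k : C(X × X, ℝ)) (y : X) : C(X, ℝ) :=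
  ⟨fun x => k (x, y), by fun_prop⟩

/-- A kernel `k` is universal if the functions `x ↦ k(x, y)`, `y ∈ X`, span a dense subspace of
`C(X)`, for uniform convergence (the topology of `C(X, ℝ)`, for a compact `X`). -/
def IsUniversalKernel (k : C(X × X, ℝ)) : Prop :=
  Dense (Submodule.span ℝ (Set.range (kernelSection k)) : Set C(X, ℝ))

/-- The kernel `k_ε = exp(-C / ε)`. -/
def gibbsKernel (ε : ℝ) (C : C(X × X, ℝ)) : C(X × X, ℝ) :=
  ⟨fun p => Real.exp (-C p / ε), by fun_prop⟩

end Kernels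

section Transport

variable {X : Type*} [TopologicalSpace X] [MeasurableSpace X]

/-- The objective of entropic unbalanced transport,
`∫ C dπ + D_φ(π₁|α) + D_φ(π₂|β) + ε KL(π|α ⊗ β)`, with values in `(-∞, +∞]`. -/
def transportObjective (φ : ℝ≥0 → ℝ≥0∞) (ε : ℝ) (C : C(X × X, ℝ)) (α β : FiniteMeasure X)
    (π : FiniteMeasure (X × X)) : EReal :=
  ((∫ p, C p ∂(π : Measure (X × X)) : ℝ) : EReal)
    + ((csiszarDiv φ ((π : Measure (X × X)).map Prod.fst) (α : Measure X)
      + csiszarDiv φ ((π : Measure (X × X)).map Prod.snd) (β : Measure X)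
      + ENNReal.ofReal ε * InformationTheory.klDiv (π : Measure (X × X))
          ((α : Measure X).prod (β : Measure X)) : ℝ≥0∞) : EReal)

/-- The regularized unbalanced optimal transport cost `OT_ε(α, β)`: the infimum of the objective
over all positive measures on `X × X`. -/
def OT (φ : ℝ≥0 → ℝ≥0∞) (ε : ℝ) (C : C(X × X, ℝ)) (α β : FiniteMeasure X) : EReal :=
  ⨅ π : FiniteMeasure (X × X), transportObjective φ ε C α β π

/-- The unbalanced Sinkhorn divergence
`S_ε(α, β) = OT_ε(α, β) - OT_ε(α, α) / 2 - OT_ε(β, β) / 2 + (ε / 2) (m(α) - m(β))²`. -/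
def sinkhornDiv (φ : ℝ≥0 → ℝ≥0∞) (ε : ℝ) (C : C(X × X, ℝ)) (α β : FiniteMeasure X) : EReal :=
  OT φ ε C α β - ((1 / 2 : ℝ) : EReal) * OT φ ε C α α - ((1 / 2 : ℝ) : EReal) * OT φ ε C β β
    + ((ε / 2 * ((α.mass : ℝ) - (β.mass : ℝ)) ^ 2 : ℝ) : EReal)

end Transport

end Sinkhorn

end

noncomputable section

namespace Sinkhorn

/-- An entropy `φ`, given on `[0, ∞)` by the continuous function `e`, together with a function `ψ`
such that `ψ u ≤ u p + e p` for `u` in the admissible set `A`; the prototype is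
`ψ u = -φ*(-u)` on the domain of finiteness. -/
structure IsEntropyPair (φ : ℝ≥0 → ℝ≥0∞) (e ψ : ℝ → ℝ) (A : Set ℝ) : Prop where
  continuous_entropy : Continuous e
  continuous_dual : Continuous ψ
  nonneg : ∀ p, 0 ≤ p → 0 ≤ e p
  eq_ofReal : ∀ p : ℝ≥0, φ p = ENNReal.ofReal (e p)
  young : ∀ u ∈ A, ∀ p, 0 ≤ p → ψ u - u * p ≤ e p

section Csiszar

variable {Ω : Type*} [MeasurableSpace Ω] {φ : ℝ≥0 → ℝ≥0∞} {e ψ : ℝ → ℝ} {A : Set ℝ}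

lemma ofReal_integral_le_lintegral_ofReal {μ : Measure Ω} (f : Ω → ℝ) :
    ENNReal.ofReal (∫ x, f x ∂μ) ≤ ∫⁻ x, ENNReal.ofReal (f x) ∂μ := by
  by_cases hf : Integrable f μ
  · have h1 : ∫ x, f x ∂μ ≤ ∫ x, max (f x) 0 ∂μ :=
      integral_mono hf hf.pos_part fun x => le_max_left _ _
    refine (ENNReal.ofReal_le_ofReal h1).trans ?_
    rw [ofReal_integral_eq_lintegral_ofReal hf.pos_part (ae_of_all _ fun x => le_max_right _ _)]
    simp [ENNReal.ofReal_max]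
  · simp [integral_undef hf]

lemma IsEntropyPair.neg_le_recession (h : IsEntropyPair φ e ψ A) {u : ℝ} (hu : u ∈ A) :
    ENNReal.ofReal (-u) ≤ recession φ := by
  have ht : Tendsto (fun p : ℝ≥0 => ENNReal.ofReal (ψ u * (p : ℝ)⁻¹ - u)) atTop
      (𝓝 (ENNReal.ofReal (-u))) := by
    refine ENNReal.tendsto_ofReal ?_
    have : Tendsto (fun p : ℝ≥0 => (p : ℝ)⁻¹) atTop (𝓝 0) :=
      tendsto_inv_atTop_zero.comp (NNReal.tendsto_coe_atTop.2 tendsto_id)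
    simpa using (this.const_mul (ψ u)).sub_const u
  rw [← ht.limsup_eq]
  refine limsup_le_limsup ?_
  filter_upwards [eventually_gt_atTop 0] with p hp
  have hp' : (0 : ℝ) < p := hp
  rw [h.eq_ofReal, ← ENNReal.ofReal_coe_nnreal, ← ENNReal.ofReal_div_of_pos hp']
  refine ENNReal.ofReal_le_ofReal ?_
  rw [le_div_iff₀ hp']
  calc (ψ u * (p : ℝ)⁻¹ - u) * p = ψ u - u * p := by field_simp
    _ ≤ e p := h.young u hu p hp'.le

lemma IsEntropyPair.le_csiszarDiv (h : IsEntropyPair φ e ψ A) (μ ν : Measure Ω)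
    [IsFiniteMeasure μ] [IsFiniteMeasure ν] {f : Ω → ℝ} (hf : Integrable f μ)
    (hψ : Integrable (fun x => ψ (f x)) ν) (hA : ∀ x, f x ∈ A) :
    ((∫ x, ψ (f x) ∂ν - ∫ x, f x ∂μ : ℝ) : EReal) ≤ (csiszarDiv φ μ ν : EReal) := by
  set r : Ω → ℝ≥0∞ := μ.rnDeriv ν with hr
  have hrm : Measurable r := Measure.measurable_rnDeriv μ ν
  have hrt : ∀ᵐ x ∂ν, r x < ∞ := Measure.rnDeriv_lt_top μ ν
  have hμ : μ.singularPart ν + ν.withDensity r = μ := Measure.singularPart_add_rnDeriv μ ν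
  have hs : Integrable f (μ.singularPart ν) := hf.mono_measure (Measure.singularPart_le μ ν)
  have hd : Integrable f (ν.withDensity r) := hf.mono_measure (Measure.withDensity_rnDeriv_le μ ν)
  have hdi : Integrable (fun x => (r x).toReal * f x) ν :=
    (integrable_withDensity_iff_integrable_smul' hrm hrt).1 hd
  have hsplit : ∫ x, f x ∂μ = ∫ x, f x ∂(μ.singularPart ν) + ∫ x, (r x).toReal * f x ∂ν := by
    conv_lhs => rw [← hμ]
    rw [integral_add_measure hs hd, integral_withDensity_eq_integral_toReal_smul hrm hrt]
    rfl
  have h1 : ENNReal.ofReal (∫ x, (ψ (f x) - (r x).toReal * f x) ∂ν)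
      ≤ ∫⁻ x, φ (r x).toNNReal ∂ν := by
    refine (ofReal_integral_le_lintegral_ofReal _).trans (lintegral_mono fun x => ?_)
    rw [h.eq_ofReal]
    refine ENNReal.ofReal_le_ofReal ?_
    rw [mul_comm]
    exact h.young _ (hA x) _ ENNReal.toReal_nonneg
  have h2 : ENNReal.ofReal (∫ x, -f x ∂(μ.singularPart ν))
      ≤ recession φ * μ.singularPart ν Set.univ := by
    refine (ofReal_integral_le_lintegral_ofReal _).trans ?_
    rw [← lintegral_const]
    exact lintegral_mono fun x => h.neg_le_recession (hA x)
  have h3 : ENNReal.ofReal (∫ x, ψ (f x) ∂ν - ∫ x, f x ∂μ) ≤ csiszarDiv φ μ ν := by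
    refine le_trans ?_ (add_le_add h1 h2)
    rw [integral_sub hψ hdi, integral_neg, hsplit]
    refine le_trans (ENNReal.ofReal_le_ofReal (le_of_eq ?_)) ENNReal.ofReal_add_le
    ring
  refine le_trans ?_ (EReal.coe_ennreal_le_coe_ennreal_iff.2 h3)
  rw [EReal.coe_ennreal_ofReal]
  exact EReal.coe_le_coe_iff.2 (le_max_left _ _)

lemma IsEntropyPair.csiszarDiv_withDensity (h : IsEntropyPair φ e ψ A) (ν : Measure Ω)
    [IsFiniteMeasure ν] {p : Ω → ℝ} (hp : Measurable p) (hp0 : ∀ x, 0 ≤ p x)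
    (hi : Integrable (fun x => e (p x)) ν) :
    csiszarDiv φ (ν.withDensity fun x => ENNReal.ofReal (p x)) ν
      = ENNReal.ofReal (∫ x, e (p x) ∂ν) := by
  rw [csiszarDiv, Measure.singularPart_withDensity, Measure.coe_zero, Pi.zero_apply, mul_zero,
    add_zero, ofReal_integral_eq_lintegral_ofReal hi (ae_of_all _ fun x => h.nonneg _ (hp0 x))]
  refine lintegral_congr_ae ?_
  filter_upwards [Measure.rnDeriv_withDensity ν hp.ennreal_ofReal] with x hx
  rw [hx, h.eq_ofReal]
  congr 2
  exact Real.coe_toNNReal _ (hp0 x)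

lemma mul_sub_exp_le {u p : ℝ} (hp : 0 ≤ p) : p * u - Real.exp u ≤ p * Real.log p - p := by
  rcases hp.eq_or_lt with rfl | hp
  · simpa using (Real.exp_pos u).le
  have h := Real.add_one_le_exp (u - Real.log p)
  rw [Real.exp_sub, Real.exp_log hp, le_div_iff₀ hp] at h
  linarith

lemma isEntropyPair_kl {ρ : ℝ} (hρ : 0 < ρ) :
    IsEntropyPair (klEntropy ρ) (fun p => ρ * (p * Real.log p - p + 1))
      (fun u => ρ * (1 - Real.exp (-u / ρ))) Set.univ where
  continuous_entropy := by
    have := Real.continuous_mul_log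
    fun_prop
  continuous_dual := by fun_prop
  nonneg p hp := by
    have := mul_sub_exp_le (u := 0) hp
    simp only [mul_zero, Real.exp_zero] at this
    exact mul_nonneg hρ.le (by linarith)
  eq_ofReal p := rfl
  young u _ p hp := by
    have := mul_le_mul_of_nonneg_left (mul_sub_exp_le (u := -u / ρ) hp) hρ.le
    have h2 : ρ * (p * (-u / ρ)) = - (u * p) := by field_simp
    linarith

lemma isEntropyPair_tv {ρ : ℝ} (hρ : 0 < ρ) :
    IsEntropyPair (tvEntropy ρ) (fun p => ρ * |p - 1|) (fun u => min ρ u) (Set.Ici (-ρ)) where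
  continuous_entropy := by fun_prop
  continuous_dual := by fun_prop
  nonneg p hp := by positivity
  eq_ofReal p := rfl
  young u hu p hp := by
    have hu : -ρ ≤ u := hu
    rcases le_total ρ u with h | h
    · rw [min_eq_left h]
      nlinarith [neg_abs_le (p - 1)]
    · rw [min_eq_right h]
      rcases abs_cases (p - 1) with ⟨h1, h2⟩ | ⟨h1, h2⟩ <;> rw [h1] <;> nlinarith

lemma csiszarDiv_klEntropy_le_klDiv (μ ν : Measure Ω) [IsFiniteMeasure μ] [IsFiniteMeasure ν] :
    csiszarDiv (klEntropy 1) μ ν ≤ InformationTheory.klDiv μ ν := by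
  by_cases h : μ ≪ ν
  · rw [InformationTheory.klDiv_eq_lintegral_klFun_of_ac h, csiszarDiv,
      Measure.singularPart_eq_zero_of_ac h, Measure.coe_zero, Pi.zero_apply, mul_zero, add_zero]
    refine lintegral_mono fun x => ENNReal.ofReal_le_ofReal (le_of_eq ?_)
    rw [InformationTheory.klFun, one_mul]
    simp only [ENNReal.coe_toNNReal_eq_toReal]
    ring
  · simp [InformationTheory.klDiv_of_not_ac h]

lemma klDiv_withDensity (ν : Measure Ω) [IsFiniteMeasure ν] {p : Ω → ℝ} (hp : Measurable p)
    (hp0 : ∀ x, 0 ≤ p x) (hpi : Integrable p ν)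
    (hi : Integrable (fun x => InformationTheory.klFun (p x)) ν) :
    InformationTheory.klDiv (ν.withDensity fun x => ENNReal.ofReal (p x)) ν
      = ENNReal.ofReal (∫ x, InformationTheory.klFun (p x) ∂ν) := by
  have : IsFiniteMeasure (ν.withDensity fun x => ENNReal.ofReal (p x)) :=
    isFiniteMeasure_withDensity_ofReal hpi.2
  rw [InformationTheory.klDiv_eq_lintegral_klFun_of_ac (withDensity_absolutelyContinuous _ _),
    ofReal_integral_eq_lintegral_ofReal hi
      (ae_of_all _ fun x => InformationTheory.klFun_nonneg (hp0 x))]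
  refine lintegral_congr_ae ?_
  filter_upwards [Measure.rnDeriv_withDensity ν hp.ennreal_ofReal] with x hx
  rw [hx, ENNReal.toReal_ofReal (hp0 x)]

end Csiszar

section Duality

variable {X : Type*} [MetricSpace X] [CompactSpace X] [MeasurableSpace X] [BorelSpace X]

instance secondCountableTopology_of_compact_metric : SecondCountableTopology X :=
  UniformSpace.secondCountable_of_separable X

lemma integrable_of_continuous {Y : Type*} [TopologicalSpace Y] [CompactSpace Y]
    [MeasurableSpace Y] [OpensMeasurableSpace Y] (μ : Measure Y) [IsFiniteMeasure μ] {f : Y → ℝ}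
    (hf : Continuous f) : Integrable f μ :=
  hf.integrable_of_hasCompactSupport (HasCompactSupport.of_compactSpace f)

/-- The measure `e^{f/ε} α`. -/
def scaledMeasure (ε : ℝ) (f : C(X, ℝ)) (α : FiniteMeasure X) : FiniteMeasure X :=
  ⟨(α : Measure X).withDensity fun x => ENNReal.ofReal (Real.exp (f x / ε)),
    isFiniteMeasure_withDensity_ofReal
      (integrable_of_continuous (α : Measure X) (by fun_prop)).2⟩

lemma toMeasure_scaledMeasure (ε : ℝ) (f : C(X, ℝ)) (α : FiniteMeasure X) :
    (scaledMeasure ε f α : Measure X)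
      = (α : Measure X).withDensity fun x => ENNReal.ofReal (Real.exp (f x / ε)) := rfl

lemma integral_scaledMeasure (ε : ℝ) (f : C(X, ℝ)) (α : FiniteMeasure X) (h : X → ℝ) :
    ∫ x, h x ∂(scaledMeasure ε f α : Measure X)
      = ∫ x, Real.exp (f x / ε) * h x ∂(α : Measure X) := by
  rw [toMeasure_scaledMeasure, integral_withDensity_eq_integral_toReal_smul (by fun_prop) (by simp)]
  simp [ENNReal.toReal_ofReal (Real.exp_pos _).le]

lemma integral_prod_scaledMeasure (ε : ℝ) (f g : C(X, ℝ)) (α β : FiniteMeasure X)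
    (h : X × X → ℝ) :
    ∫ z, h z ∂((scaledMeasure ε f α : Measure X).prod (scaledMeasure ε g β : Measure X))
      = ∫ z, Real.exp ((f z.1 + g z.2) / ε) * h z ∂((α : Measure X).prod (β : Measure X)) := by
  rw [toMeasure_scaledMeasure, toMeasure_scaledMeasure,
    prod_withDensity (by fun_prop) (by fun_prop),
    integral_withDensity_eq_integral_toReal_smul (by fun_prop)
      (by simp [ENNReal.mul_lt_top])]
  refine integral_congr_ae (ae_of_all _ fun z => ?_)
  simp [ENNReal.toReal_ofReal (Real.exp_pos _).le, add_div, Real.exp_add]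

/-- The function `x ↦ ∫ k(x, y) dμ(y)`. -/
def kernelIntegral (k : C(X × X, ℝ)) (μ : FiniteMeasure X) : C(X, ℝ) where
  toFun x := ∫ y, k (x, y) ∂(μ : Measure X)
  continuous_toFun := by
    refine continuous_of_dominated (bound := fun _ => ‖k‖) (fun x => ?_) (fun x => ?_)
      (integrable_const _) (ae_of_all _ fun y => by fun_prop)
    · exact Continuous.aestronglyMeasurable (by fun_prop)
    · exact ae_of_all _ fun y => k.norm_coe_le_norm _

lemma kernelIntegral_apply (k : C(X × X, ℝ)) (μ : FiniteMeasure X) (x : X) :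
    kernelIntegral k μ x = ∫ y, k (x, y) ∂(μ : Measure X) := rfl

lemma integral_prod_eq_integral_kernelIntegral (k : C(X × X, ℝ)) (μ ν : FiniteMeasure X) :
    ∫ z, k z ∂((μ : Measure X).prod (ν : Measure X))
      = ∫ x, kernelIntegral k ν x ∂(μ : Measure X) :=
  integral_prod _ (integrable_of_continuous _ k.continuous)

/-- The logarithmic density of the entropic plan with respect to `α ⊗ β`,
`(f(x) + g(y) - C(x, y)) / ε`. -/
def logDensity (ε : ℝ) (C : C(X × X, ℝ)) (f g : C(X, ℝ)) : C(X × X, ℝ) :=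
  ⟨fun z => (f z.1 + g z.2 - C z) / ε, by fun_prop⟩

lemma exp_logDensity (ε : ℝ) (C : C(X × X, ℝ)) (f g : C(X, ℝ)) (z : X × X) :
    Real.exp (logDensity ε C f g z)
      = Real.exp ((f z.1 + g z.2) / ε) * gibbsKernel ε C z := by
  simp only [logDensity, gibbsKernel, ContinuousMap.coe_mk]
  rw [← Real.exp_add]
  congr 1
  ring

lemma integral_exp_logDensity (ε : ℝ) (C : C(X × X, ℝ)) (f g : C(X, ℝ)) (α β : FiniteMeasure X) :
    ∫ z, Real.exp (logDensity ε C f g z) ∂((α : Measure X).prod (β : Measure X))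
      = ∫ z, gibbsKernel ε C z
        ∂((scaledMeasure ε f α : Measure X).prod (scaledMeasure ε g β : Measure X)) := by
  rw [integral_prod_scaledMeasure]
  simp_rw [exp_logDensity]

/-- The dual functional of entropic unbalanced transport. -/
def dualValue (ψ : ℝ → ℝ) (ε : ℝ) (C : C(X × X, ℝ)) (f g : C(X, ℝ)) (α β : FiniteMeasure X) : ℝ :=
  ∫ x, ψ (f x) ∂(α : Measure X) + ∫ x, ψ (g x) ∂(β : Measure X)
    - ε * (∫ z, gibbsKernel ε C z
        ∂((scaledMeasure ε f α : Measure X).prod (scaledMeasure ε g β : Measure X))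
      - α.mass * β.mass)

variable {φ : ℝ≥0 → ℝ≥0∞} {e ψ : ℝ → ℝ} {A : Set ℝ} {ε : ℝ}

lemma IsEntropyPair.dualValue_le_OT (h : IsEntropyPair φ e ψ A) (hε : 0 < ε) (C : C(X × X, ℝ))
    {f g : C(X, ℝ)} (hf : ∀ x, f x ∈ A) (hg : ∀ x, g x ∈ A) (α β : FiniteMeasure X) :
    (dualValue ψ ε C f g α β : EReal) ≤ OT φ ε C α β := by
  refine le_iInf fun π => ?_
  have hψ := h.continuous_dual
  have h1 := h.le_csiszarDiv ((π : Measure (X × X)).map Prod.fst) (α : Measure X)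
    (integrable_of_continuous _ f.continuous) (integrable_of_continuous _ (by fun_prop)) hf
  have h2 := h.le_csiszarDiv ((π : Measure (X × X)).map Prod.snd) (β : Measure X)
    (integrable_of_continuous _ g.continuous) (integrable_of_continuous _ (by fun_prop)) hg
  have h3 := (isEntropyPair_kl one_pos).le_csiszarDiv (π : Measure (X × X))
    ((α : Measure X).prod (β : Measure X)) (f := fun z => -logDensity ε C f g z)
    (integrable_of_continuous _ (by fun_prop)) (integrable_of_continuous _ (by fun_prop))
    (fun _ => Set.mem_univ _)
  replace h3 := h3.trans (EReal.coe_ennreal_le_coe_ennreal_iff.2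
    (csiszarDiv_klEntropy_le_klDiv (π : Measure (X × X)) ((α : Measure X).prod (β : Measure X))))
  rw [integral_map (by fun_prop) (by fun_prop)] at h1 h2
  have h4 := mul_le_mul_of_nonneg_left h3 (EReal.coe_nonneg.2 hε.le)
  rw [transportObjective, EReal.coe_ennreal_add, EReal.coe_ennreal_add, EReal.coe_ennreal_mul,
    EReal.coe_ennreal_ofReal, max_eq_left hε.le]
  refine le_trans ?_ (add_le_add le_rfl (add_le_add (add_le_add h1 h2) h4))
  rw [← EReal.coe_mul, ← EReal.coe_add, ← EReal.coe_add, ← EReal.coe_add, EReal.coe_le_coe_iff]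
  have e1 : ∫ z, logDensity ε C f g z ∂(π : Measure (X × X))
      = ε⁻¹ * (∫ z, f z.1 ∂(π : Measure (X × X)) + ∫ z, g z.2 ∂(π : Measure (X × X))
        - ∫ z, C z ∂(π : Measure (X × X))) := by
    rw [← integral_add (integrable_of_continuous _ (by fun_prop))
      (integrable_of_continuous _ (by fun_prop)), ← integral_sub
      (integrable_of_continuous _ (by fun_prop)) (integrable_of_continuous _ (by fun_prop)),
      ← integral_const_mul]
    refine integral_congr_ae (ae_of_all _ fun z => ?_)
    simp [logDensity, div_eq_inv_mul]
  have e2 : ∫ z, (1 : ℝ) * (1 - Real.exp (-(-logDensity ε C f g z) / 1))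
        ∂((α : Measure X).prod (β : Measure X))
      = α.mass * β.mass - ∫ z, gibbsKernel ε C z
        ∂((scaledMeasure ε f α : Measure X).prod (scaledMeasure ε g β : Measure X)) := by
    simp only [one_mul, neg_neg, div_one]
    rw [integral_sub (integrable_const _) (integrable_of_continuous _ (by fun_prop)),
      integral_exp_logDensity, integral_const, smul_eq_mul, mul_one, ← Set.univ_prod_univ,
      measureReal_prod_prod]
    rfl
  rw [e2, integral_neg, e1, dualValue]
  refine le_of_eq ?_
  field_simp
  ring

/-- The entropic plan with density `e^{(f(x) + g(y) - C(x, y)) / ε}` with respect to `α ⊗ β`. -/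
def gibbsPlan (ε : ℝ) (C : C(X × X, ℝ)) (f g : C(X, ℝ)) (α β : FiniteMeasure X) :
    FiniteMeasure (X × X) :=
  ⟨((α : Measure X).prod (β : Measure X)).withDensity
      fun z => ENNReal.ofReal (Real.exp (logDensity ε C f g z)),
    isFiniteMeasure_withDensity_ofReal (integrable_of_continuous _ (by fun_prop)).2⟩

lemma toMeasure_gibbsPlan (ε : ℝ) (C : C(X × X, ℝ)) (f g : C(X, ℝ)) (α β : FiniteMeasure X) :
    (gibbsPlan ε C f g α β : Measure (X × X)) = ((α : Measure X).prod (β : Measure X)).withDensity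
      fun z => ENNReal.ofReal (Real.exp (logDensity ε C f g z)) := rfl

/-- The density of the first marginal of the entropic plan. -/
def marginalDensity (ε : ℝ) (C : C(X × X, ℝ)) (f g : C(X, ℝ)) (β : FiniteMeasure X) : C(X, ℝ) :=
  ⟨fun x => Real.exp (f x / ε) * kernelIntegral (gibbsKernel ε C) (scaledMeasure ε g β) x,
    by fun_prop⟩

lemma marginalDensity_apply (ε : ℝ) (C : C(X × X, ℝ)) (f g : C(X, ℝ)) (β : FiniteMeasure X)
    (x : X) : marginalDensity ε C f g β x
      = Real.exp (f x / ε) * kernelIntegral (gibbsKernel ε C) (scaledMeasure ε g β) x := rfl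

lemma marginalDensity_eq_integral (ε : ℝ) (C : C(X × X, ℝ)) (f g : C(X, ℝ)) (β : FiniteMeasure X)
    (x : X) : marginalDensity ε C f g β x
      = ∫ y, Real.exp (logDensity ε C f g (x, y)) ∂(β : Measure X) := by
  rw [marginalDensity_apply, kernelIntegral_apply, integral_scaledMeasure, ← integral_const_mul]
  simp_rw [exp_logDensity, add_div, Real.exp_add, mul_assoc]

lemma marginalDensity_nonneg (ε : ℝ) (C : C(X × X, ℝ)) (f g : C(X, ℝ)) (β : FiniteMeasure X)
    (x : X) : 0 ≤ marginalDensity ε C f g β x := by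
  rw [marginalDensity_eq_integral]
  exact integral_nonneg fun y => (Real.exp_pos _).le

lemma map_fst_gibbsPlan (ε : ℝ) (C : C(X × X, ℝ)) (f g : C(X, ℝ)) (α β : FiniteMeasure X) :
    (gibbsPlan ε C f g α β : Measure (X × X)).map Prod.fst
      = (α : Measure X).withDensity fun x => ENNReal.ofReal (marginalDensity ε C f g β x) := by
  ext s hs
  rw [Measure.map_apply measurable_fst hs, toMeasure_gibbsPlan,
    withDensity_apply _ (measurable_fst hs), withDensity_apply _ hs, ← Set.prod_univ,
    ← Measure.prod_restrict, lintegral_prod _ (by fun_prop), Measure.restrict_univ]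
  refine lintegral_congr fun x => ?_
  rw [marginalDensity_eq_integral, ofReal_integral_eq_lintegral_ofReal
    (integrable_of_continuous _ (by fun_prop)) (ae_of_all _ fun y => (Real.exp_pos _).le)]

lemma map_snd_gibbsPlan (ε : ℝ) (C : C(X × X, ℝ)) (hsymm : ∀ x y, C (x, y) = C (y, x))
    (f g : C(X, ℝ)) (α β : FiniteMeasure X) :
    (gibbsPlan ε C f g α β : Measure (X × X)).map Prod.snd
      = (β : Measure X).withDensity fun x => ENNReal.ofReal (marginalDensity ε C g f α x) := by
  ext s hs
  rw [Measure.map_apply measurable_snd hs, toMeasure_gibbsPlan,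
    withDensity_apply _ (measurable_snd hs), withDensity_apply _ hs, ← Set.univ_prod,
    ← Measure.prod_restrict, lintegral_prod_symm _ (by fun_prop), Measure.restrict_univ]
  refine lintegral_congr fun x => ?_
  rw [marginalDensity_eq_integral, ofReal_integral_eq_lintegral_ofReal
    (integrable_of_continuous _ (by fun_prop)) (ae_of_all _ fun y => (Real.exp_pos _).le)]
  refine lintegral_congr fun y => ?_
  simp only [logDensity, ContinuousMap.coe_mk, hsymm y x, add_comm (f y)]

/-- The value of the transport objective at the entropic plan with potentials `(f, f)`. -/
def planValue (e : ℝ → ℝ) (ε : ℝ) (C : C(X × X, ℝ)) (f : C(X, ℝ)) (α β : FiniteMeasure X) : ℝ :=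
  ∫ z, (Real.exp (logDensity ε C f f z) * C z
      + ε * InformationTheory.klFun (Real.exp (logDensity ε C f f z)))
      ∂((α : Measure X).prod (β : Measure X))
    + ∫ x, e (marginalDensity ε C f f β x) ∂(α : Measure X)
    + ∫ x, e (marginalDensity ε C f f α x) ∂(β : Measure X)

lemma IsEntropyPair.OT_le_planValue (h : IsEntropyPair φ e ψ A) (hε : 0 < ε) (C : C(X × X, ℝ))
    (hsymm : ∀ x y, C (x, y) = C (y, x)) (f : C(X, ℝ)) (α β : FiniteMeasure X) :
    OT φ ε C α β ≤ (planValue e ε C f α β : EReal) := by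
  refine (iInf_le _ (gibbsPlan ε C f f α β)).trans (le_of_eq ?_)
  have he := h.continuous_entropy
  have hk := InformationTheory.continuous_klFun
  have hc : ∀ γ : FiniteMeasure X, Continuous fun x => e (marginalDensity ε C f f γ x) :=
    fun γ => by fun_prop
  rw [transportObjective, map_fst_gibbsPlan, map_snd_gibbsPlan ε C hsymm,
    h.csiszarDiv_withDensity _ (by fun_prop) (marginalDensity_nonneg ε C f f β)
      (integrable_of_continuous _ (hc β)),
    h.csiszarDiv_withDensity _ (by fun_prop) (marginalDensity_nonneg ε C f f α)
      (integrable_of_continuous _ (hc α)), toMeasure_gibbsPlan,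
    klDiv_withDensity _ (by fun_prop) (fun z => (Real.exp_pos _).le)
      (integrable_of_continuous _ (by fun_prop)) (integrable_of_continuous _ (by fun_prop)),
    integral_withDensity_eq_integral_toReal_smul (by fun_prop) (by simp)]
  have n1 : ∀ γ δ : FiniteMeasure X, 0 ≤ ∫ x, e (marginalDensity ε C f f γ x) ∂(δ : Measure X) :=
    fun γ δ => integral_nonneg fun x => h.nonneg _ (marginalDensity_nonneg ε C f f γ x)
  have n3 : 0 ≤ ∫ z, InformationTheory.klFun (Real.exp (logDensity ε C f f z))
      ∂((α : Measure X).prod (β : Measure X)) :=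
    integral_nonneg fun z => InformationTheory.klFun_nonneg (Real.exp_pos _).le
  rw [← ENNReal.ofReal_mul hε.le, ← ENNReal.ofReal_add (n1 _ _) (n1 _ _),
    ← ENNReal.ofReal_add (add_nonneg (n1 _ _) (n1 _ _)) (mul_nonneg hε.le n3),
    EReal.coe_ennreal_ofReal, max_eq_left
      (add_nonneg (add_nonneg (n1 _ _) (n1 _ _)) (mul_nonneg hε.le n3)), ← EReal.coe_add,
    EReal.coe_eq_coe_iff, planValue, integral_add (integrable_of_continuous _ (by fun_prop))
      (integrable_of_continuous _ (by fun_prop)), integral_const_mul]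
  simp_rw [ENNReal.toReal_ofReal (Real.exp_pos _).le, smul_eq_mul]
  ring

/-- An admissible function `f` satisfying, `α`-almost everywhere, the optimality conditions of the
dual problem of `OT_ε(α, α)`; the first condition expresses `α` through `e^{f/ε} α`. -/
structure IsPotential (e ψ Ψ : ℝ → ℝ) (A : Set ℝ) (ε : ℝ) (C : C(X × X, ℝ)) (α : FiniteMeasure X)
    (f : C(X, ℝ)) : Prop where
  mem : ∀ x, f x ∈ A
  exp_neg : ∀ᵐ x ∂(α : Measure X), Real.exp (-(f x / ε))
    = Ψ (kernelIntegral (gibbsKernel ε C) (scaledMeasure ε f α) x)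
  young_eq : ∀ᵐ x ∂(α : Measure X), e (marginalDensity ε C f f α x)
    = ψ (f x) - f x * marginalDensity ε C f f α x

lemma IsPotential.planValue_eq_dualValue {Ψ : ℝ → ℝ} {C : C(X × X, ℝ)}
    {α : FiniteMeasure X} {f : C(X, ℝ)} (hf : IsPotential e ψ Ψ A ε C α f)
    (h : IsEntropyPair φ e ψ A) (hε : 0 < ε) (hsymm : ∀ x y, C (x, y) = C (y, x)) :
    planValue e ε C f α α = dualValue ψ ε C f f α α := by
  have hψ := h.continuous_dual
  have i1 : ∫ x, e (marginalDensity ε C f f α x) ∂(α : Measure X)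
      = ∫ x, ψ (f x) ∂(α : Measure X)
        - ∫ x, f x * marginalDensity ε C f f α x ∂(α : Measure X) := by
    rw [integral_congr_ae hf.young_eq, integral_sub (integrable_of_continuous _ (by fun_prop))
      (integrable_of_continuous _ (by fun_prop))]
  have i2 : ∫ x, f x * marginalDensity ε C f f α x ∂(α : Measure X)
      = ∫ z, f z.1 * Real.exp (logDensity ε C f f z) ∂((α : Measure X).prod (α : Measure X)) := by
    rw [integral_prod _ (integrable_of_continuous _ (by fun_prop))]
    simp_rw [integral_const_mul, marginalDensity_eq_integral]
  have i3 : ∫ x, f x * marginalDensity ε C f f α x ∂(α : Measure X)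
      = ∫ z, f z.2 * Real.exp (logDensity ε C f f z) ∂((α : Measure X).prod (α : Measure X)) := by
    rw [i2, ← integral_prod_swap]
    refine integral_congr_ae (ae_of_all _ fun ⟨x, y⟩ => ?_)
    simp [logDensity, hsymm y x, add_comm (f y)]
  have i4 : ∫ z, (Real.exp (logDensity ε C f f z) * C z
      + ε * InformationTheory.klFun (Real.exp (logDensity ε C f f z)))
      ∂((α : Measure X).prod (α : Measure X))
      = ∫ z, f z.1 * Real.exp (logDensity ε C f f z) ∂((α : Measure X).prod (α : Measure X))
        + ∫ z, f z.2 * Real.exp (logDensity ε C f f z) ∂((α : Measure X).prod (α : Measure X))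
        + ε * (α.mass * α.mass
          - ∫ z, Real.exp (logDensity ε C f f z) ∂((α : Measure X).prod (α : Measure X))) := by
    have : (α.mass * α.mass : ℝ) = ∫ z, (1 : ℝ) ∂((α : Measure X).prod (α : Measure X)) := by
      rw [integral_const, smul_eq_mul, mul_one, ← Set.univ_prod_univ, measureReal_prod_prod]
      rfl
    rw [this, ← integral_sub (integrable_const _) (integrable_of_continuous _ (by fun_prop)),
      ← integral_const_mul, ← integral_add (integrable_of_continuous _ (by fun_prop))
      (integrable_of_continuous _ (by fun_prop)), ← integral_add
      (integrable_of_continuous _ (by fun_prop)) (integrable_of_continuous _ (by fun_prop))]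
    refine integral_congr_ae (ae_of_all _ fun z => ?_)
    simp only [InformationTheory.klFun, Real.log_exp]
    have : ε * logDensity ε C f f z = f z.1 + f z.2 - C z := by
      simp only [logDensity, ContinuousMap.coe_mk]
      field_simp
    linear_combination Real.exp (logDensity ε C f f z) * this
  rw [planValue, dualValue, i4, ← i2, ← i3, i1, ← integral_exp_logDensity]
  ring

end Duality

section Kernel

variable {X : Type*} [MetricSpace X] [CompactSpace X] [MeasurableSpace X] [BorelSpace X]

/-- The energy `∬ k dσ dσ` of the signed measure `σ = μ - ν`. -/
def kernelEnergy (k : C(X × X, ℝ)) (μ ν : FiniteMeasure X) : ℝ :=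
  (∫ p, k p ∂((μ : Measure X).prod (μ : Measure X)))
    - (∫ p, k p ∂((μ : Measure X).prod (ν : Measure X)))
    - (∫ p, k p ∂((ν : Measure X).prod (μ : Measure X)))
    + (∫ p, k p ∂((ν : Measure X).prod (ν : Measure X)))

lemma kernelEnergy_comm (k : C(X × X, ℝ)) (μ ν : FiniteMeasure X) :
    kernelEnergy k μ ν = kernelEnergy k ν μ := by
  unfold kernelEnergy; ring

lemma integral_prod_comm {k : C(X × X, ℝ)} (hk : ∀ x y, k (x, y) = k (y, x))
    (μ ν : FiniteMeasure X) :
    ∫ p, k p ∂((μ : Measure X).prod (ν : Measure X))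
      = ∫ p, k p ∂((ν : Measure X).prod (μ : Measure X)) := by
  rw [← integral_prod_swap]
  exact integral_congr_ae (ae_of_all _ fun ⟨x, y⟩ => hk y x)

lemma sq_kernelIntegral_sub_le_of_nonpos {k : C(X × X, ℝ)} (hk : ∀ x y, k (x, y) = k (y, x))
    (hpos : IsPositiveKernel k) (μ ν : FiniteMeasure X) (x : X) (hx : k (x, x) = 1)
    (hD : kernelIntegral k μ x - kernelIntegral k ν x ≤ 0) :
    (kernelIntegral k μ x - kernelIntegral k ν x) ^ 2 ≤ kernelEnergy k μ ν := by
  set t : ℝ≥0 := Real.toNNReal (-(kernelIntegral k μ x - kernelIntegral k ν x)) with ht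
  have htc : (t : ℝ) = -(kernelIntegral k μ x - kernelIntegral k ν x) :=
    Real.coe_toNNReal _ (by linarith)
  set δ : FiniteMeasure X := μ + t • (diracProba x).toFiniteMeasure with hδ
  have hint : ∀ h : C(X, ℝ), ∫ y, h y ∂(δ : Measure X) = ∫ y, h y ∂(μ : Measure X) + t * h x := by
    intro h
    rw [hδ, FiniteMeasure.toMeasure_add, FiniteMeasure.toMeasure_smul,
      integral_add_measure (integrable_of_continuous _ h.continuous)
      (integrable_of_continuous (t • ((diracProba x).toFiniteMeasure : Measure X)) h.continuous),
      integral_smul_nnreal_measure]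
    have hdir : ((diracProba x).toFiniteMeasure : Measure X) = Measure.dirac x := rfl
    simp [NNReal.smul_def, hdir]
  have hker : ∀ y, kernelIntegral k δ y = kernelIntegral k μ y + t * k (y, x) := fun y =>
    hint ⟨fun z => k (y, z), by fun_prop⟩
  have h := hpos δ ν
  have hsec : ∀ m : FiniteMeasure X,
      ∫ y, k (y, x) ∂(m : Measure X) = kernelIntegral k m x := fun m => by
    simp_rw [kernelIntegral_apply, hk x]
  have hadd : ∀ m : FiniteMeasure X, ∫ y, (kernelIntegral k μ y + t * k (y, x)) ∂(m : Measure X)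
      = ∫ y, kernelIntegral k μ y ∂(m : Measure X) + t * kernelIntegral k m x := fun m => by
    rw [integral_add (integrable_of_continuous _ (by fun_prop))
      (integrable_of_continuous _ (by fun_prop)), integral_const_mul, hsec]
  rw [integral_prod_comm hk ν δ] at h
  simp only [integral_prod_eq_integral_kernelIntegral, hint, hker, hadd, hx] at h
  rw [kernelEnergy, integral_prod_comm hk ν μ]
  simp only [integral_prod_eq_integral_kernelIntegral]
  rw [htc] at h
  nlinarith

lemma sq_kernelIntegral_sub_le {k : C(X × X, ℝ)} (hk : ∀ x y, k (x, y) = k (y, x))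
    (hpos : IsPositiveKernel k) (μ ν : FiniteMeasure X) (x : X) (hx : k (x, x) = 1) :
    (kernelIntegral k μ x - kernelIntegral k ν x) ^ 2 ≤ kernelEnergy k μ ν := by
  rcases le_total (kernelIntegral k μ x - kernelIntegral k ν x) 0 with h | h
  · exact sq_kernelIntegral_sub_le_of_nonpos hk hpos μ ν x hx h
  · rw [kernelEnergy_comm, ← neg_sq, neg_sub]
    exact sq_kernelIntegral_sub_le_of_nonpos hk hpos ν μ x hx (by linarith)

section Convergence

variable {k : C(X × X, ℝ)} {μs : ℕ → FiniteMeasure X} {μ : FiniteMeasure X}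

lemma tendsto_kernelIntegral_of_tendsto_kernelEnergy (hk : ∀ x y, k (x, y) = k (y, x))
    (hpos : IsPositiveKernel k) (hdiag : ∀ x, k (x, x) = 1)
    (h : Tendsto (fun n => kernelEnergy k (μs n) μ) atTop (𝓝 0)) :
    Tendsto (fun n => kernelIntegral k (μs n)) atTop (𝓝 (kernelIntegral k μ)) := by
  rw [tendsto_iff_dist_tendsto_zero]
  have hs : Tendsto (fun n => √(kernelEnergy k (μs n) μ)) atTop (𝓝 0) := by
    simpa using h.sqrt
  refine squeeze_zero (fun _ => dist_nonneg) (fun n => ?_) hs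
  rw [ContinuousMap.dist_le (Real.sqrt_nonneg _)]
  intro x
  rw [Real.dist_eq]
  exact Real.abs_le_sqrt (sq_kernelIntegral_sub_le hk hpos _ _ x (hdiag x))

lemma exists_mass_le_of_tendsto_kernelIntegral (hk0 : ∀ z, 0 < k z)
    (h : Tendsto (fun n => kernelIntegral k (μs n)) atTop (𝓝 (kernelIntegral k μ))) :
    ∃ M : ℝ, ∀ n, ((μs n).mass : ℝ) ≤ M := by
  rcases isEmpty_or_nonempty X with hX | ⟨⟨x⟩⟩
  · exact ⟨0, fun n => le_of_eq (by simp [FiniteMeasure.mass, Set.eq_empty_of_isEmpty])⟩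
  obtain ⟨z, -, hz⟩ := (isCompact_univ (X := X × X)).exists_isMinOn ⟨(x, x), Set.mem_univ _⟩
    k.continuous.continuousOn
  obtain ⟨B, hB⟩ := (((continuous_eval_const x).tendsto _).comp h).bddAbove_range
  refine ⟨B / k z, fun n => ?_⟩
  rw [le_div_iff₀ (hk0 z)]
  refine le_trans ?_ (hB ⟨n, rfl⟩)
  have : ∫ y, k z ∂(μs n : Measure X) ≤ kernelIntegral k (μs n) x :=
    integral_mono (integrable_const _) (integrable_of_continuous _ (by fun_prop))
      fun y => hz (Set.mem_univ _)
  rw [integral_const, smul_eq_mul] at this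
  exact this

lemma abs_integral_sub_le (m : FiniteMeasure X) (f g : C(X, ℝ)) :
    |∫ x, f x ∂(m : Measure X) - ∫ x, g x ∂(m : Measure X)| ≤ dist f g * m.mass := by
  rw [← integral_sub (integrable_of_continuous _ f.continuous)
    (integrable_of_continuous _ g.continuous)]
  exact norm_integral_le_of_norm_le_const (f := fun x => f x - g x) (ae_of_all _ fun x => by
    rw [← dist_eq_norm]; exact ContinuousMap.dist_apply_le_dist x)

lemma tendsto_integral_of_tendsto_of_mass_le {f : C(X, ℝ)} {fs : ℕ → C(X, ℝ)}
    (hfs : Tendsto fs atTop (𝓝 f)) {M : ℝ} (hM : ∀ n, ((μs n).mass : ℝ) ≤ M)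
    (h : Tendsto (fun n => ∫ x, f x ∂(μs n : Measure X)) atTop (𝓝 (∫ x, f x ∂(μ : Measure X)))) :
    Tendsto (fun n => ∫ x, fs n x ∂(μs n : Measure X)) atTop (𝓝 (∫ x, f x ∂(μ : Measure X))) := by
  have h0 : Tendsto (fun n => ∫ x, fs n x ∂(μs n : Measure X) - ∫ x, f x ∂(μs n : Measure X))
      atTop (𝓝 0) := by
    refine squeeze_zero_norm (a := fun n => dist (fs n) f * M) (fun n => ?_) ?_
    · exact (abs_integral_sub_le _ _ _).trans
        (mul_le_mul_of_nonneg_left (hM n) dist_nonneg)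
    · simpa using (tendsto_iff_dist_tendsto_zero.1 hfs).mul_const M
  simpa using h0.add h

lemma tendsto_integral_of_dense {S : Submodule ℝ C(X, ℝ)} (hS : Dense (S : Set C(X, ℝ)))
    {M : ℝ} (hM : ∀ n, ((μs n).mass : ℝ) ≤ M)
    (h : ∀ f ∈ S, Tendsto (fun n => ∫ x, f x ∂(μs n : Measure X)) atTop
      (𝓝 (∫ x, f x ∂(μ : Measure X)))) (f : C(X, ℝ)) :
    Tendsto (fun n => ∫ x, f x ∂(μs n : Measure X)) atTop (𝓝 (∫ x, f x ∂(μ : Measure X))) := by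
  have hM0 : 0 ≤ M := (NNReal.coe_nonneg _).trans (hM 0)
  rw [Metric.tendsto_atTop]
  intro η hη
  have hc : 0 < M + μ.mass + 1 := by positivity
  obtain ⟨g, hg, hgS⟩ := Metric.dense_iff.1 hS f (η / 2 / (M + μ.mass + 1)) (by positivity)
  obtain ⟨N, hN⟩ := Metric.tendsto_atTop.1 (h g hgS) (η / 2) (by positivity)
  refine ⟨N, fun n hn => ?_⟩
  have h1 := abs_integral_sub_le (μs n) f g
  have h2 := abs_integral_sub_le μ g f
  have h3 := hN n hn
  rw [Metric.mem_ball, lt_div_iff₀ hc] at hg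
  rw [Real.dist_eq] at h3 ⊢
  rw [dist_comm] at h1
  have h4 := mul_le_mul_of_nonneg_left (hM n) (dist_nonneg (x := g) (y := f))
  have h5 : 0 ≤ dist g f := dist_nonneg
  rw [abs_le] at h1 h2
  rw [abs_lt] at h3 ⊢
  constructor <;> nlinarith

lemma tendsto_finiteMeasure_iff :
    Tendsto μs atTop (𝓝 μ) ↔ ∀ f : C(X, ℝ), Tendsto (fun n => ∫ x, f x ∂(μs n : Measure X)) atTop
      (𝓝 (∫ x, f x ∂(μ : Measure X))) := by
  rw [FiniteMeasure.tendsto_iff_forall_integral_tendsto]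
  exact ⟨fun h f => h (BoundedContinuousFunction.mkOfCompact f), fun h f => h f.toContinuousMap⟩

lemma tendsto_integral_of_tendsto_kernelIntegral (hk : ∀ x y, k (x, y) = k (y, x))
    (huniv : IsUniversalKernel k) {M : ℝ} (hM : ∀ n, ((μs n).mass : ℝ) ≤ M)
    (h : Tendsto (fun n => kernelIntegral k (μs n)) atTop (𝓝 (kernelIntegral k μ))) :
    Tendsto μs atTop (𝓝 μ) := by
  refine tendsto_finiteMeasure_iff.2 (tendsto_integral_of_dense huniv hM fun f hf => ?_)
  induction hf using Submodule.span_induction with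
  | mem f hf =>
    obtain ⟨y, rfl⟩ := hf
    have hsec : ∀ m : FiniteMeasure X,
        ∫ x, kernelSection k y x ∂(m : Measure X) = kernelIntegral k m y := fun m => by
      simp_rw [kernelIntegral_apply, hk y]; rfl
    simp_rw [hsec]
    exact ((continuous_eval_const y).tendsto _).comp h
  | zero => simp
  | add f g _ _ hf hg =>
    have : ∀ m : FiniteMeasure X, ∫ x, (f + g) x ∂(m : Measure X)
        = ∫ x, f x ∂(m : Measure X) + ∫ x, g x ∂(m : Measure X) := fun m =>
      integral_add (integrable_of_continuous _ f.continuous)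
        (integrable_of_continuous _ g.continuous)
    simp_rw [this]
    exact hf.add hg
  | smul c f _ hf =>
    have : ∀ m : FiniteMeasure X, ∫ x, (c • f) x ∂(m : Measure X)
        = c * ∫ x, f x ∂(m : Measure X) := fun m => integral_const_mul c _
    simp_rw [this]
    exact hf.const_mul c

lemma tendsto_finiteMeasure_prod {αs βs : ℕ → FiniteMeasure X} {α β : FiniteMeasure X}
    (hα : Tendsto αs atTop (𝓝 α)) (hβ : Tendsto βs atTop (𝓝 β)) :
    Tendsto (fun n => (αs n).prod (βs n)) atTop (𝓝 (α.prod β)) := by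
  rcases isEmpty_or_nonempty X with hX | hX
  · have hs : Subsingleton (FiniteMeasure (X × X)) :=
      ⟨fun a b => Subtype.ext (Subsingleton.elim (α := Measure (X × X)) _ _)⟩
    rw [Subsingleton.elim (fun n => (αs n).prod (βs n)) (fun _ => α.prod β)]
    exact tendsto_const_nhds
  have hm : Tendsto (fun n => ((αs n).prod (βs n)).mass) atTop (𝓝 (α.mass * β.mass)) := by
    simp_rw [FiniteMeasure.mass_prod]
    exact hα.mass.mul hβ.mass
  rcases eq_or_ne α 0 with rfl | hα0
  · rw [FiniteMeasure.zero_prod]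
    exact FiniteMeasure.tendsto_zero_of_tendsto_zero_mass (by simpa using hm)
  rcases eq_or_ne β 0 with rfl | hβ0
  · rw [FiniteMeasure.prod_zero]
    exact FiniteMeasure.tendsto_zero_of_tendsto_zero_mass (by simpa using hm)
  have hself : ∀ a b : FiniteMeasure X, a.prod b
      = (a.mass * b.mass) • (a.normalize.prod b.normalize).toFiniteMeasure := by
    intro a b
    refine Subtype.ext ?_
    change (a : Measure X).prod (b : Measure X) = _
    conv_lhs => rw [a.self_eq_mass_smul_normalize, b.self_eq_mass_smul_normalize]
    rw [FiniteMeasure.toMeasure_smul, FiniteMeasure.toMeasure_smul]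
    rw [Measure.prod_smul_left, Measure.prod_smul_right, smul_smul]
    rfl
  have hN := (ProbabilityMeasure.continuous_prod.tendsto (α.normalize, β.normalize)).comp
    ((FiniteMeasure.tendsto_normalize_of_tendsto hα hα0).prodMk_nhds
      (FiniteMeasure.tendsto_normalize_of_tendsto hβ hβ0))
  rw [ProbabilityMeasure.tendsto_nhds_iff_toFiniteMeasure_tendsto_nhds] at hN
  rw [hself α β]
  simp_rw [hself (αs _)]
  exact (hα.mass.mul hβ.mass).smul hN

end Convergence

end Kernel

section Divergence

variable {X : Type*} [MetricSpace X] [CompactSpace X] [MeasurableSpace X] [BorelSpace X]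
  {φ : ℝ≥0 → ℝ≥0∞} {e ψ Ψ : ℝ → ℝ} {A : Set ℝ} {ε : ℝ} {C : C(X × X, ℝ)}

lemma IsEntropyPair.exists_coe_eq_OT (h : IsEntropyPair φ e ψ A) (hε : 0 < ε)
    (hsymm : ∀ x y, C (x, y) = C (y, x)) {f : C(X, ℝ)} (hf : ∀ x, f x ∈ A)
    (α β : FiniteMeasure X) : ∃ r : ℝ, OT φ ε C α β = r := by
  refine ⟨(OT φ ε C α β).toReal, (EReal.coe_toReal (fun h0 => ?_) fun h0 => ?_).symm⟩
  · have := h.OT_le_planValue hε C hsymm f α β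
    rw [h0] at this
    exact absurd (top_le_iff.1 this) (EReal.coe_ne_top _)
  · have := h.dualValue_le_OT hε C hf hf α β
    rw [h0] at this
    exact absurd (le_bot_iff.1 this) (EReal.coe_ne_bot _)

lemma IsEntropyPair.le_sinkhornDiv (h : IsEntropyPair φ e ψ A) (hε : 0 < ε)
    (hsymm : ∀ x y, C (x, y) = C (y, x)) {α β : FiniteMeasure X} {f g : C(X, ℝ)}
    (hf : IsPotential e ψ Ψ A ε C α f) (hg : IsPotential e ψ Ψ A ε C β g) :
    ((ε / 2 * kernelEnergy (gibbsKernel ε C) (scaledMeasure ε f α) (scaledMeasure ε g β) : ℝ)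
      : EReal) ≤ sinkhornDiv φ ε C α β := by
  have h1 := h.dualValue_le_OT hε C hf.mem hg.mem α β
  have h2 := h.OT_le_planValue hε C hsymm f α α
  have h3 := h.OT_le_planValue hε C hsymm g β β
  rw [hf.planValue_eq_dualValue h hε hsymm] at h2
  rw [hg.planValue_eq_dualValue h hε hsymm] at h3
  obtain ⟨a, ha⟩ := h.exists_coe_eq_OT hε hsymm hf.mem α β
  obtain ⟨b, hb⟩ := h.exists_coe_eq_OT hε hsymm hf.mem α α
  obtain ⟨c, hc⟩ := h.exists_coe_eq_OT hε hsymm hf.mem β β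
  rw [sinkhornDiv]
  rw [ha] at h1 ⊢
  rw [hb] at h2 ⊢
  rw [hc] at h3 ⊢
  norm_cast at h1 h2 h3 ⊢
  rw [dualValue] at h1 h2 h3
  rw [kernelEnergy, integral_prod_comm (k := gibbsKernel ε C)
    (fun x y => by simp [gibbsKernel, hsymm x y]) (scaledMeasure ε g β) (scaledMeasure ε f α)]
  linarith

lemma IsEntropyPair.sinkhornDiv_le (h : IsEntropyPair φ e ψ A) (hε : 0 < ε)
    (hsymm : ∀ x y, C (x, y) = C (y, x)) {f : C(X, ℝ)} (hf : ∀ x, f x ∈ A)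
    (α β : FiniteMeasure X) :
    sinkhornDiv φ ε C α β ≤ ((planValue e ε C f α β - 1 / 2 * dualValue ψ ε C f f α α
      - 1 / 2 * dualValue ψ ε C f f β β + ε / 2 * ((α.mass : ℝ) - β.mass) ^ 2 : ℝ) : EReal) := by
  have h1 := h.OT_le_planValue hε C hsymm f α β
  have h2 := h.dualValue_le_OT hε C hf hf α α
  have h3 := h.dualValue_le_OT hε C hf hf β β
  obtain ⟨a, ha⟩ := h.exists_coe_eq_OT hε hsymm hf α β
  obtain ⟨b, hb⟩ := h.exists_coe_eq_OT hε hsymm hf α α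
  obtain ⟨c, hc⟩ := h.exists_coe_eq_OT hε hsymm hf β β
  rw [sinkhornDiv]
  rw [ha] at h1 ⊢
  rw [hb] at h2 ⊢
  rw [hc] at h3 ⊢
  norm_cast at h1 h2 h3 ⊢
  linarith

variable {αs : ℕ → FiniteMeasure X} {α : FiniteMeasure X}

lemma tendsto_integral_of_tendsto_finiteMeasure {Y : Type*} [TopologicalSpace Y] [CompactSpace Y]
    [MeasurableSpace Y] [OpensMeasurableSpace Y] {μs : ℕ → FiniteMeasure Y} {μ : FiniteMeasure Y}
    (h : Tendsto μs atTop (𝓝 μ)) {f : Y → ℝ} (hf : Continuous f) :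
    Tendsto (fun n => ∫ x, f x ∂(μs n : Measure Y)) atTop (𝓝 (∫ x, f x ∂(μ : Measure Y))) :=
  FiniteMeasure.tendsto_iff_forall_integral_tendsto.1 h
    (BoundedContinuousFunction.mkOfCompact ⟨f, hf⟩)

lemma tendsto_marginalDensity (ε : ℝ) (C : C(X × X, ℝ)) (f : C(X, ℝ))
    (h : Tendsto αs atTop (𝓝 α)) (x : X) :
    Tendsto (fun n => marginalDensity ε C f f (αs n) x) atTop
      (𝓝 (marginalDensity ε C f f α x)) := by
  simp_rw [marginalDensity_eq_integral]
  exact tendsto_integral_of_tendsto_finiteMeasure h (by fun_prop)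

lemma IsEntropyPair.tendsto_planValue (h : IsEntropyPair φ e ψ A) (f : C(X, ℝ))
    (hα : Tendsto αs atTop (𝓝 α)) :
    Tendsto (fun n => planValue e ε C f (αs n) α) atTop (𝓝 (planValue e ε C f α α)) := by
  have he := h.continuous_entropy
  have hk := InformationTheory.continuous_klFun
  refine ((?_ : Tendsto _ _ _).add ?_).add ?_
  · exact tendsto_integral_of_tendsto_finiteMeasure
      (tendsto_finiteMeasure_prod hα tendsto_const_nhds) (by fun_prop)
  · exact tendsto_integral_of_tendsto_finiteMeasure hα (by fun_prop)
  · obtain ⟨M, hM⟩ := hα.mass.bddAbove_range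
    obtain ⟨B, hB⟩ := (isCompact_univ (X := X × X)).exists_bound_of_continuousOn
      (f := fun z => Real.exp (logDensity ε C f f z)) (by fun_prop)
    obtain ⟨K, hK⟩ := (isCompact_Icc (a := (0 : ℝ)) (b := B * M)).exists_bound_of_continuousOn
      he.continuousOn
    refine tendsto_integral_of_dominated_convergence (fun _ => K)
      (fun n => Continuous.aestronglyMeasurable (by fun_prop)) (integrable_const _)
      (fun n => ae_of_all _ fun x => hK _ ⟨marginalDensity_nonneg _ _ _ _ _ _, ?_⟩)
      (ae_of_all _ fun x => (he.tendsto _).comp (tendsto_marginalDensity ε C f hα x))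
    rw [marginalDensity_eq_integral]
    refine (le_abs_self _).trans ((norm_integral_le_of_norm_le_const
      (ae_of_all _ fun y => hB (x, y) (Set.mem_univ _))).trans ?_)
    refine mul_le_mul_of_nonneg_left ?_ ((norm_nonneg _).trans (hB (x, x) (Set.mem_univ _)))
    exact_mod_cast hM ⟨n, rfl⟩

lemma IsEntropyPair.tendsto_dualValue (h : IsEntropyPair φ e ψ A) (f : C(X, ℝ))
    (hα : Tendsto αs atTop (𝓝 α)) :
    Tendsto (fun n => dualValue ψ ε C f f (αs n) (αs n)) atTop
      (𝓝 (dualValue ψ ε C f f α α)) := by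
  have hψ := h.continuous_dual
  have hm : Tendsto (fun n => ((αs n).mass : ℝ)) atTop (𝓝 α.mass) :=
    (NNReal.continuous_coe.tendsto _).comp hα.mass
  have h1 := tendsto_integral_of_tendsto_finiteMeasure hα (f := fun x => ψ (f x)) (by fun_prop)
  have h2 := tendsto_integral_of_tendsto_finiteMeasure (tendsto_finiteMeasure_prod hα hα)
    (f := fun z => Real.exp (logDensity ε C f f z)) (by fun_prop)
  simp only [FiniteMeasure.toMeasure_prod, integral_exp_logDensity] at h2
  exact (h1.add h1).sub ((h2.sub (hm.mul hm)).const_mul ε)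

lemma kernelEnergy_nonneg {k : C(X × X, ℝ)} (hpos : IsPositiveKernel k) (μ ν : FiniteMeasure X) :
    0 ≤ kernelEnergy k μ ν := hpos μ ν

lemma IsEntropyPair.tendsto_sinkhornDiv (h : IsEntropyPair φ e ψ A) (hε : 0 < ε)
    (hsymm : ∀ x y, C (x, y) = C (y, x)) (hpos : IsPositiveKernel (gibbsKernel ε C))
    (hex : ∀ β : FiniteMeasure X, ∃ f, IsPotential e ψ Ψ A ε C β f)
    (hα : Tendsto αs atTop (𝓝 α)) :
    Tendsto (fun n => sinkhornDiv φ ε C (αs n) α) atTop (𝓝 0) := by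
  obtain ⟨f, hf⟩ := hex α
  choose g hg using fun n => hex (αs n)
  refine tendsto_of_tendsto_of_tendsto_of_le_of_le tendsto_const_nhds ?_
    (fun n => le_trans ?_ (h.le_sinkhornDiv hε hsymm (hg n) hf))
    (fun n => h.sinkhornDiv_le hε hsymm hf.mem (αs n) α)
  · rw [← EReal.coe_zero, EReal.tendsto_coe]
    have hm : Tendsto (fun n => ((αs n).mass : ℝ)) atTop (𝓝 α.mass) :=
      (NNReal.continuous_coe.tendsto _).comp hα.mass
    have := ((((h.tendsto_planValue (ε := ε) (C := C) f hα).sub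
      ((h.tendsto_dualValue (ε := ε) (C := C) f hα).const_mul (1 / 2))).sub_const
      (1 / 2 * dualValue ψ ε C f f α α)).add (((hm.sub_const (α.mass : ℝ)).pow 2).const_mul
      (ε / 2)))
    convert this using 2
    rw [hf.planValue_eq_dualValue h hε hsymm]
    ring
  · exact EReal.coe_nonneg.2 (mul_nonneg (by positivity) (kernelEnergy_nonneg hpos _ _))

lemma IsPotential.integral_eq {f : C(X, ℝ)} (hf : IsPotential e ψ Ψ A ε C α f) (u : X → ℝ) :
    ∫ x, u x ∂(α : Measure X)
      = ∫ x, u x * Ψ (kernelIntegral (gibbsKernel ε C) (scaledMeasure ε f α) x)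
        ∂(scaledMeasure ε f α : Measure X) := by
  rw [integral_scaledMeasure]
  refine integral_congr_ae ?_
  filter_upwards [hf.exp_neg] with x hx
  rw [← hx, mul_left_comm, ← Real.exp_add]
  simp

lemma IsEntropyPair.tendsto_of_tendsto_sinkhornDiv (h : IsEntropyPair φ e ψ A) (hε : 0 < ε)
    (hsymm : ∀ x y, C (x, y) = C (y, x)) (hdiag : ∀ x, C (x, x) = 0)
    (hpos : IsPositiveKernel (gibbsKernel ε C)) (huniv : IsUniversalKernel (gibbsKernel ε C))
    (hΨ : Continuous Ψ) (hex : ∀ β : FiniteMeasure X, ∃ f, IsPotential e ψ Ψ A ε C β f)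
    (hS : Tendsto (fun n => sinkhornDiv φ ε C (αs n) α) atTop (𝓝 0)) :
    Tendsto αs atTop (𝓝 α) := by
  obtain ⟨f, hf⟩ := hex α
  choose g hg using fun n => hex (αs n)
  set k := gibbsKernel ε C with hk
  have hks : ∀ x y, k (x, y) = k (y, x) := fun x y => by simp [hk, gibbsKernel, hsymm x y]
  have hkd : ∀ x, k (x, x) = 1 := fun x => by simp [hk, gibbsKernel, hdiag x]
  set μ := scaledMeasure ε f α with hμ
  set μs := fun n => scaledMeasure ε (g n) (αs n) with hμs
  have hE : Tendsto (fun n => kernelEnergy k (μs n) μ) atTop (𝓝 0) := by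
    have h1 : Tendsto (fun n => ((ε / 2 * kernelEnergy k (μs n) μ : ℝ) : EReal)) atTop (𝓝 0) :=
      tendsto_of_tendsto_of_tendsto_of_le_of_le tendsto_const_nhds hS
        (fun n => EReal.coe_nonneg.2 (mul_nonneg (by positivity) (kernelEnergy_nonneg hpos _ _)))
        (fun n => h.le_sinkhornDiv hε hsymm (hg n) hf)
    rw [← EReal.coe_zero, EReal.tendsto_coe] at h1
    have h2 := h1.const_mul (ε / 2)⁻¹
    rw [mul_zero] at h2
    refine h2.congr fun n => ?_
    field_simp
  have hT := tendsto_kernelIntegral_of_tendsto_kernelEnergy hks hpos hkd hE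
  obtain ⟨M, hM⟩ := exists_mass_le_of_tendsto_kernelIntegral
    (fun z => Real.exp_pos _) hT
  have hw := tendsto_integral_of_tendsto_kernelIntegral hks huniv hM hT
  rw [tendsto_finiteMeasure_iff]
  intro u
  have hcomp : Continuous fun v : C(X, ℝ) => u * (ContinuousMap.mk Ψ hΨ).comp v :=
    continuous_const.mul (ContinuousMap.continuous_postcomp _)
  rw [hf.integral_eq]
  simp_rw [fun n => (hg n).integral_eq u]
  exact tendsto_integral_of_tendsto_of_mass_le ((hcomp.tendsto _).comp hT) hM
    (tendsto_finiteMeasure_iff.1 hw _)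

end Divergence

lemma exists_fixedPoint_smul_of_lipschitzWith_one {E : Type*} [NormedAddCommGroup E]
    [NormedSpace ℝ E] [CompleteSpace E] {T : E → E} (hT : LipschitzWith 1 T) {a : ℝ≥0}
    (ha : a < 1) : ∃ f, f = (a : ℝ) • T f := by
  have h : ContractingWith a fun f => (a : ℝ) • T f := by
    refine ⟨ha, LipschitzWith.of_dist_le_mul fun f g => ?_⟩
    rw [dist_smul₀, Real.norm_of_nonneg a.coe_nonneg]
    simpa using mul_le_mul_of_nonneg_left (hT.dist_le_mul f g) a.coe_nonneg
  exact ⟨_, h.fixedPoint_isFixedPt.symm⟩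

lemma exists_fixedPoint_of_lipschitzWith_one {E : Type*} [NormedAddCommGroup E]
    [NormedSpace ℝ E] [CompleteSpace E] {T : E → E} (hT : LipschitzWith 1 T) {S : Set E}
    (hS : IsCompact S) (hTS : ∀ f, ∀ a : ℝ≥0, a ≤ 1 → (a : ℝ) • T f ∈ S) : ∃ f ∈ S, f = T f := by
  obtain ⟨a, -, ha, ha1⟩ := exists_seq_strictMono_tendsto' (zero_lt_one (α := ℝ≥0))
  choose f hf using fun n => exists_fixedPoint_smul_of_lipschitzWith_one hT (ha n).2
  obtain ⟨g, hgS, s, hs, hg⟩ := hS.tendsto_subseq (x := f)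
    fun n => hf n ▸ hTS (f n) (a n) (ha n).2.le
  refine ⟨g, hgS, tendsto_nhds_unique hg ?_⟩
  have h1 : Tendsto (fun n => (a (s n) : ℝ) • T (f (s n))) atTop (𝓝 ((1 : ℝ) • T g)) :=
    ((NNReal.continuous_coe.tendsto 1).comp (ha1.comp hs.tendsto_atTop)).smul
      ((hT.continuous.tendsto g).comp hg)
  rw [one_smul] at h1
  exact h1.congr fun n => (hf (s n)).symm

lemma isCompact_setOf_mem_Icc_and_lipschitzWith {X : Type*} [PseudoMetricSpace X]
    (a b : ℝ) (γ : ℝ≥0) :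
    IsCompact {f : C(X, ℝ) | (∀ x, f x ∈ Set.Icc a b) ∧ LipschitzWith γ f} := by
  refine ArzelaAscoli.isCompact_of_equicontinuous _ ?_ ?_
  · have : ContinuousMap.toFun '' {f : C(X, ℝ) | (∀ x, f x ∈ Set.Icc a b) ∧ LipschitzWith γ f}
        = (Set.univ.pi fun _ : X => Set.Icc a b) ∩ {g | LipschitzWith γ g} := by
      ext g
      constructor
      · rintro ⟨f, ⟨h1, h2⟩, rfl⟩
        exact ⟨fun x _ => h1 x, h2⟩
      · rintro ⟨h1, h2⟩
        exact ⟨⟨g, h2.continuous⟩, ⟨fun x => h1 x trivial, h2⟩, rfl⟩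
    rw [this]
    exact (isCompact_univ_pi fun _ => isCompact_Icc).inter_right (isClosed_setOfPred_lipschitzWith γ)
  · exact (LipschitzWith.uniformEquicontinuous _ γ fun f => f.2.2).equicontinuous

section Potentials

variable {X : Type*} [MetricSpace X] [CompactSpace X] [MeasurableSpace X] [BorelSpace X]

lemma kernelIntegral_scaledMeasure_eq (ε : ℝ) (C : C(X × X, ℝ)) (α : FiniteMeasure X)
    (f : C(X, ℝ)) (x : X) : kernelIntegral (gibbsKernel ε C) (scaledMeasure ε f α) x
      = ∫ y, Real.exp ((f y - C (x, y)) / ε) ∂(α : Measure X) := by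
  rw [kernelIntegral_apply, integral_scaledMeasure]
  refine integral_congr_ae (ae_of_all _ fun y => ?_)
  simp only [gibbsKernel, ContinuousMap.coe_mk]
  rw [← Real.exp_add]
  ring_nf

lemma kernelIntegral_scaledMeasure_pos (ε : ℝ) (C : C(X × X, ℝ)) {α : FiniteMeasure X}
    (hα : α ≠ 0) (f : C(X, ℝ)) (x : X) :
    0 < kernelIntegral (gibbsKernel ε C) (scaledMeasure ε f α) x := by
  have : NeZero (α : Measure X) := ⟨fun h => hα (Subtype.ext h)⟩
  rw [kernelIntegral_scaledMeasure_eq]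
  exact integral_exp_pos (integrable_of_continuous _ (by fun_prop))

/-- The soft minimum `x ↦ -ε log ∫ e^{(f(y) - C(x, y)) / ε} dα(y)`. -/
def softMin (ε : ℝ) (C : C(X × X, ℝ)) {α : FiniteMeasure X} (hα : α ≠ 0) (f : C(X, ℝ)) :
    C(X, ℝ) where
  toFun x := -ε * Real.log (kernelIntegral (gibbsKernel ε C) (scaledMeasure ε f α) x)
  continuous_toFun := continuous_const.mul (Continuous.log (by fun_prop)
    fun x => (kernelIntegral_scaledMeasure_pos ε C hα f x).ne')

lemma softMin_apply (ε : ℝ) (C : C(X × X, ℝ)) {α : FiniteMeasure X} (hα : α ≠ 0) (f : C(X, ℝ))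
    (x : X) : softMin ε C hα f x
      = -ε * Real.log (kernelIntegral (gibbsKernel ε C) (scaledMeasure ε f α) x) := rfl

lemma softMin_le_add {ε : ℝ} (hε : 0 < ε) (C : C(X × X, ℝ)) {α : FiniteMeasure X} (hα : α ≠ 0)
    {f g : C(X, ℝ)} {x x' : X} {δ : ℝ} (h : ∀ y, g y - C (x', y) ≤ f y - C (x, y) + δ) :
    softMin ε C hα f x ≤ softMin ε C hα g x' + δ := by
  have h1 : kernelIntegral (gibbsKernel ε C) (scaledMeasure ε g α) x'
      ≤ Real.exp (δ / ε) * kernelIntegral (gibbsKernel ε C) (scaledMeasure ε f α) x := by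
    rw [kernelIntegral_scaledMeasure_eq, kernelIntegral_scaledMeasure_eq, ← integral_const_mul]
    refine integral_mono (integrable_of_continuous _ (by fun_prop))
      (integrable_of_continuous _ (by fun_prop)) fun y => ?_
    simp only
    rw [← Real.exp_add, ← add_div, Real.exp_le_exp]
    gcongr
    linarith [h y]
  have h2 := Real.log_le_log (kernelIntegral_scaledMeasure_pos ε C hα g x') h1
  rw [Real.log_mul (Real.exp_pos _).ne' (kernelIntegral_scaledMeasure_pos ε C hα f x).ne',
    Real.log_exp] at h2
  have h3 := mul_le_mul_of_nonneg_left h2 hε.le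
  rw [mul_add, mul_div_cancel₀ _ hε.ne'] at h3
  rw [softMin_apply, softMin_apply]
  linarith

lemma lipschitzWith_one_softMin {ε : ℝ} (hε : 0 < ε) (C : C(X × X, ℝ)) {α : FiniteMeasure X}
    (hα : α ≠ 0) : LipschitzWith 1 (softMin ε C hα) := by
  refine LipschitzWith.of_dist_le_mul fun f g => ?_
  rw [NNReal.coe_one, one_mul, ContinuousMap.dist_le dist_nonneg]
  have key : ∀ f g : C(X, ℝ), ∀ x, softMin ε C hα f x ≤ softMin ε C hα g x + dist f g := by
    refine fun f g x => softMin_le_add hε C hα fun y => ?_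
    have := ContinuousMap.dist_apply_le_dist (f := f) (g := g) y
    rw [Real.dist_eq] at this
    linarith [neg_abs_le (f y - g y)]
  intro x
  rw [Real.dist_eq, abs_le]
  constructor
  · have := key g f x
    rw [dist_comm] at this
    linarith
  · linarith [key f g x]

lemma lipschitzWith_softMin {ε : ℝ} (hε : 0 < ε) {C : C(X × X, ℝ)} {γ : ℝ≥0}
    (hlip : ∀ z, LipschitzWith γ fun x => C (x, z)) {α : FiniteMeasure X} (hα : α ≠ 0)
    (f : C(X, ℝ)) : LipschitzWith γ (softMin ε C hα f) := by
  refine LipschitzWith.of_le_add_mul γ fun x x' => softMin_le_add hε C hα fun y => ?_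
  have := (abs_le.1 ((Real.dist_eq _ _).symm.le.trans ((hlip y).dist_le_mul x x'))).2
  linarith

lemma isPotential_zero_measure {e ψ Ψ : ℝ → ℝ} {A : Set ℝ} {ε : ℝ} {C : C(X × X, ℝ)}
    (h0 : (0 : ℝ) ∈ A) : IsPotential e ψ Ψ A ε C 0 0 :=
  ⟨fun _ => h0, by simp, by simp⟩

lemma exists_isPotential_kl {ε ρ : ℝ} (hε : 0 < ε) (hρ : 0 < ρ) (C : C(X × X, ℝ))
    (α : FiniteMeasure X) :
    ∃ f, IsPotential (fun p => ρ * (p * Real.log p - p + 1))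
      (fun u => ρ * (1 - Real.exp (-u / ρ))) (fun t => t ^ (ρ / (ε + ρ))) Set.univ ε C α f := by
  rcases eq_or_ne α 0 with rfl | hα
  · exact ⟨0, isPotential_zero_measure (Set.mem_univ _)⟩
  set a : ℝ≥0 := ⟨ρ / (ε + ρ), by positivity⟩ with ha
  have hac : (a : ℝ) = ρ / (ε + ρ) := rfl
  have ha1 : a < 1 := by
    rw [← NNReal.coe_lt_coe, hac, NNReal.coe_one, div_lt_one (by positivity)]
    linarith
  obtain ⟨f, hf⟩ := exists_fixedPoint_smul_of_lipschitzWith_one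
    (lipschitzWith_one_softMin hε C hα) ha1
  have hfx : ∀ x, f x / ε = -(Real.log (kernelIntegral (gibbsKernel ε C)
      (scaledMeasure ε f α) x) * (ρ / (ε + ρ))) := fun x => by
    conv_lhs => rw [hf]
    rw [ContinuousMap.smul_apply, softMin_apply, hac, smul_eq_mul]
    field_simp
  refine ⟨f, fun _ => Set.mem_univ _, ae_of_all _ fun x => ?_, ae_of_all _ fun x => ?_⟩
  · rw [hfx, neg_neg, Real.rpow_def_of_pos (kernelIntegral_scaledMeasure_pos ε C hα f x)]
  · have hx := hfx x
    rw [marginalDensity_apply]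
    set t := kernelIntegral (gibbsKernel ε C) (scaledMeasure ε f α) x with ht
    have ht0 : 0 < t := kernelIntegral_scaledMeasure_pos ε C hα f x
    have hlog : Real.log (Real.exp (f x / ε) * t) = -f x / ρ := by
      rw [Real.log_mul (Real.exp_pos _).ne' ht0.ne', Real.log_exp]
      field_simp at hx ⊢
      linear_combination hx
    have hexp : Real.exp (-f x / ρ) = Real.exp (f x / ε) * t := by
      rw [← hlog, Real.exp_log (by positivity)]
    rw [hlog, hexp]
    field_simp
    ring

lemma exists_isPotential_tv {ε ρ : ℝ} (hε : 0 < ε) (hρ : 0 < ρ) {C : C(X × X, ℝ)} {γ : ℝ≥0}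
    (hlip : ∀ z, LipschitzWith γ fun x => C (x, z)) (α : FiniteMeasure X) :
    ∃ f, IsPotential (fun p => ρ * |p - 1|) (fun u => min ρ u)
      (fun t => min (Real.exp (ρ / ε)) (max (Real.exp (-(ρ / ε))) t)) (Set.Ici (-ρ)) ε C α f := by
  rcases eq_or_ne α 0 with rfl | hα
  · exact ⟨0, isPotential_zero_measure (by simpa using hρ.le)⟩
  have hclip : LipschitzWith 1 fun v : ℝ => max (-ρ) (min ρ v) :=
    (LipschitzWith.id.const_min ρ).const_max (-ρ)
  set T : C(X, ℝ) → C(X, ℝ) := fun f =>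
    (ContinuousMap.mk _ hclip.continuous).comp (softMin ε C hα f) with hT
  have hTx : ∀ f x, T f x = max (-ρ) (min ρ (softMin ε C hα f x)) := fun _ _ => rfl
  have hTm : ∀ f x, T f x ∈ Set.Icc (-ρ) ρ := fun f x =>
    ⟨le_max_left _ _, max_le (by linarith) (min_le_left _ _)⟩
  have hT1 : LipschitzWith 1 T := by
    refine LipschitzWith.of_dist_le_mul fun f g => ?_
    rw [ContinuousMap.dist_le (by positivity)]
    intro x
    refine (hclip.dist_le_mul _ _).trans ?_
    rw [NNReal.coe_one, one_mul, one_mul]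
    refine (ContinuousMap.dist_apply_le_dist x).trans ?_
    simpa using (lipschitzWith_one_softMin hε C hα).dist_le_mul f g
  obtain ⟨f, ⟨hfm, -⟩, hf⟩ := exists_fixedPoint_of_lipschitzWith_one hT1
    (isCompact_setOf_mem_Icc_and_lipschitzWith (X := X) (-ρ) ρ γ) (fun f a ha => by
      have ha' : (a : ℝ) ≤ 1 := ha
      refine ⟨fun x => ?_, LipschitzWith.of_dist_le_mul fun x y => ?_⟩
      · have := abs_le.2 (hTm f x)
        rw [ContinuousMap.smul_apply, smul_eq_mul, Set.mem_Icc, ← abs_le, abs_mul,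
          abs_of_nonneg a.coe_nonneg]
        exact (mul_le_of_le_one_left (abs_nonneg _) ha').trans this
      · rw [ContinuousMap.smul_apply, ContinuousMap.smul_apply, dist_smul₀,
          Real.norm_of_nonneg a.coe_nonneg]
        refine (mul_le_of_le_one_left dist_nonneg ha').trans ((hclip.dist_le_mul _ _).trans ?_)
        rw [NNReal.coe_one, one_mul]
        exact (lipschitzWith_softMin hε hlip hα f).dist_le_mul x y)
  have hfx : ∀ x, f x = max (-ρ) (min ρ (softMin ε C hα f x)) := fun x => by
    conv_lhs => rw [hf]
    rfl
  refine ⟨f, fun x => (hfm x).1, ae_of_all _ fun x => ?_, ae_of_all _ fun x => ?_⟩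
  · have ht0 := kernelIntegral_scaledMeasure_pos ε C hα f x
    have hneg : -(f x / ε) = min (ρ / ε) (max (-(ρ / ε)) (Real.log
        (kernelIntegral (gibbsKernel ε C) (scaledMeasure ε f α) x))) := by
      rw [hfx, softMin_apply, ← neg_div, ← min_neg_neg, ← max_neg_neg, neg_neg,
        ← min_div_div_right hε.le, ← max_div_div_right hε.le, neg_div, neg_mul, neg_neg,
        mul_div_cancel_left₀ _ hε.ne']
    rw [hneg, Real.exp_monotone.map_min, Real.exp_monotone.map_max, Real.exp_log ht0]
  · have hx := hfx x
    rw [softMin_apply] at hx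
    rw [marginalDensity_apply]
    have ht0 : 0 < kernelIntegral (gibbsKernel ε C) (scaledMeasure ε f α) x :=
      kernelIntegral_scaledMeasure_pos ε C hα f x
    generalize kernelIntegral (gibbsKernel ε C) (scaledMeasure ε f α) x = t at hx ht0 ⊢
    have hp : Real.exp (f x / ε) * t = Real.exp ((f x + ε * Real.log t) / ε) := by
      rw [add_div, mul_div_cancel_left₀ _ hε.ne', Real.exp_add, Real.exp_log ht0]
    rw [hp]
    rcases le_total ρ (-ε * Real.log t) with h1 | h1
    · rw [min_eq_left h1, max_eq_right (by linarith)] at hx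
      rw [hx, min_self, abs_of_nonpos]
      · ring
      · rw [sub_nonpos, Real.exp_le_one_iff]
        exact div_nonpos_of_nonpos_of_nonneg (by linarith) hε.le
    · rw [min_eq_right h1] at hx
      rcases le_total (-ε * Real.log t) (-ρ) with h2 | h2
      · rw [max_eq_left h2] at hx
        rw [hx, min_eq_right (by linarith), abs_of_nonneg]
        · ring
        · rw [sub_nonneg, Real.one_le_exp_iff]
          exact div_nonneg (by linarith) hε.le
      · rw [max_eq_right h2] at hx
        have h0 : (f x + ε * Real.log t) / ε = 0 := by
          rw [hx]
          simp
        rw [h0, hx, min_eq_right h1]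
        simp

end Potentials

end Sinkhorn

end

theorem mainTheorem4 {X : Type*} [MetricSpace X] [CompactSpace X] [MeasurableSpace X]
    [BorelSpace X] (C : C(X × X, ℝ)) (hsymm : ∀ x y, C (x, y) = C (y, x))
    (hdiag : ∀ x, C (x, x) = 0) (γ : ℝ≥0) (hlip : ∀ z, LipschitzWith γ (fun x => C (x, z)))
    (ε : ℝ) (hε : 0 < ε) (hpos : Sinkhorn.IsPositiveKernel (Sinkhorn.gibbsKernel ε C))
    (huniv : Sinkhorn.IsUniversalKernel (Sinkhorn.gibbsKernel ε C))
    (ρ : ℝ) (hρ : 0 < ρ) (φ : ℝ≥0 → ℝ≥0∞)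
    (hφ : φ = Sinkhorn.klEntropy ρ ∨ φ = Sinkhorn.tvEntropy ρ)
    (αs : ℕ → FiniteMeasure X) (hαs : ∀ n, αs n ≠ 0) (α : FiniteMeasure X) :
    Tendsto αs atTop (𝓝 α) ↔
      Tendsto (fun n => Sinkhorn.sinkhornDiv φ ε C (αs n) α) atTop (𝓝 0) := by
  rcases hφ with rfl | rfl
  · have h := Sinkhorn.isEntropyPair_kl hρ
    have hex := Sinkhorn.exists_isPotential_kl hε hρ C
    exact ⟨fun hα => h.tendsto_sinkhornDiv hε hsymm hpos hex hα,
      fun hS => h.tendsto_of_tendsto_sinkhornDiv hε hsymm hdiag hpos huniv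
        (Real.continuous_rpow_const (by positivity)) hex hS⟩
  · have h := Sinkhorn.isEntropyPair_tv hρ
    have hex := Sinkhorn.exists_isPotential_tv hε hρ hlip
    exact ⟨fun hα => h.tendsto_sinkhornDiv hε hsymm hpos hex hα,
      fun hS => h.tendsto_of_tendsto_sinkhornDiv hε hsymm hdiag hpos huniv
        (by fun_prop) hex hS⟩
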